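/- Let $\mathbb{D}$ be the open unit disk and $\mathbb{S}^1$ the unit circle of $\mathbb{C}$. For $\alpha\in\mathbb{D}$ put $\rho=(1-|\alpha|^2)^{1/2}$ and $$\Theta(\alpha)=\begin{pmatrix}\overline{\alpha}&\rho\\ \rho&-\alpha\end{pmatrix}.$$ For $n\ge 0$, $\alpha_0,\dots,\alpha_{n-1}\in\mathbb{D}$ and $b_n\in\mathbb{S}^1$ let $\Theta_j=\Theta(\alpha_j)$ and let $\mathcal{C}(\alpha_0,\dots,\alpha_{n-1},b_n)=\mathcal{L}\mathcal{M}$ be the unitary $(n+1)\times(n+1)$ matrix with $\mathcal{L}=\Theta_0\oplus\Theta_2\oplus\cdots\oplus\Theta_{n-2}\oplus\overline{b}_n$, $\mathcal{M}=1\oplus\Theta_1\oplus\Theta_3\oplus\cdots\oplus\Theta_{n-1}$ if $n$ is even, and $\mathcal{L}=\Theta_0\oplus\Theta_2\oplus\cdots\oplus\Theta_{n-1}$, $\mathcal{M}=1\oplus\Theta_1\oplus\Theta_3\oplus\cdots\oplus\Theta_{n-2}\oplus\overline{b}_n$ if $n$ is odd. Write $\sigma(\cdot)$ for the spectrum (as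 a set). Two nonempty finite subsets of $\mathbb{S}^1$, with $p\le q$ elements, *strictly interlace* if the one with $p$ elements can be completed by $q-p$ points of $\mathbb{S}^1$ to a set with $q$ elements such that each open arc of $\mathbb{S}^1$ connecting two distinct elements of the completed set contains an element of the other set, and vice versa. **Theorem 1.** Let $n\ge0$, $\alpha_0,\dots,\alpha_{n-1}\in\mathbb{D}$ and $b_n\in\mathbb{S}^1$. (i) Let $\beta\in\mathbb{S}^1\setminus\{1\}$ and, for $0\le m\le n$, let $\mathcal{C}_m^\beta=\mathcal{C}(\alpha_0,\dots,\alpha_{m-1},\beta\alpha_m,\dots,\beta\alpha_{n-1},\beta b_n)$ (so $\mathcal{C}_n^\beta=\mathcal{C}(\alpha_0,\dots,\alpha_{n-1},\beta b_n)$). Then $\sigma(\mathcal{C}(\alpha_0,\dots,\alpha_{n-1},b_n))$ and $\sigma(\mathcal{C}_m^\beta)$ strictly interlace on $\mathbb{S}^1$ for every $0\le m\le n$. (ii) Let $0\le m<n$ and $b_m\in\mathbb{S}^1$. For $\zeta\in\mathbb{S}^1$ define recursively $b_n(\zeta)=b_n$ and $$b_j(\zeta)=\frac{\overline{\zeta}\,\alpha_j+b_{j+1}(\zeta)}{\overline{\alpha}_j\,b_{j+1}(\zeta)+\overline{\zeta}}\qquad(j=n-1,\dots,1,0).$$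 Put $$\gamma_m=\frac{\alpha_m-b_m}{\overline{\alpha}_m b_m-1},\qquad \mathcal{N}=\mathcal{C}(\alpha_{m+1},\dots,\alpha_{n-1},b_n)\,\mathrm{diag}(\gamma_m,1,\dots,1),$$ $$A=\{\zeta\in\mathbb{S}^1: b_m(\zeta)=b_m\}\cap\sigma(\mathcal{C}(\alpha_0,\dots,\alpha_{m-1},b_m)),\qquad B=\sigma(\mathcal{N})\setminus A.$$ Then $\mathcal{C}(\alpha_0,\dots,\alpha_{n-1},b_n)$ and $\mathcal{C}(\alpha_0,\dots,\alpha_{m-1},b_m)$ have at most $\min\{m+1,n-m\}$ common eigenvalues; the set of their common eigenvalues is $A$; moreover $A=\sigma(\mathcal{N})\cap\sigma(\mathcal{C}(\alpha_0,\dots,\alpha_{m-1},b_m))$; and the sets $\sigma(\mathcal{C}(\alpha_0,\dots,\alpha_{n-1},b_n))\setminus A$ and $\sigma(\mathcal{C}(\alpha_0,\dots,\alpha_{m-1},b_m))\cup B$ strictly interlace on $\mathbb{S}^1$. -/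

import Mathlib

open scoped ComplexConjugate

noncomputable section

namespace CMV

/-- The number `ρ = (1 - |a|²)^{1/2}`, as a complex number. -/
def rho (a : ℂ) : ℂ := ((Real.sqrt (1 - ‖a‖ ^ 2) : ℝ) : ℂ)

/-- The two-by-two block `Θ(a)`. -/
def theta (a : ℂ) : Matrix (Fin 2) (Fin 2) ℂ :=
  !![conj a, rho a; rho a, -a]

/-- The residue of `i` modulo two, as an index of a two-by-two block. -/
def par (i : ℕ) : Fin 2 := ⟨i % 2, Nat.mod_lt i (by decide)⟩

/-- The block diagonal matrix `Θ₀ ⊕ Θ₂ ⊕ ⋯` of order `n + 1`, whose last block is the one-by-one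
block `conj b` if `n` is even and `Θ_{n-1}` if `n` is odd. The two-by-two block with number `k`
occupies the positions `2 k` and `2 k + 1`. Only `α 0, …, α (n - 1)` are used. -/
def matL (n : ℕ) (α : ℕ → ℂ) (b : ℂ) : Matrix (Fin (n + 1)) (Fin (n + 1)) ℂ :=
  Matrix.of fun i j =>
    if (i : ℕ) / 2 = (j : ℕ) / 2 then
      if 2 * ((i : ℕ) / 2) = n then conj b
      else theta (α (2 * ((i : ℕ) / 2))) (par i) (par j)
    else 0

/-- The block diagonal matrix `1 ⊕ Θ₁ ⊕ Θ₃ ⊕ ⋯` of order `n + 1`, whose last block is `Θ_{n-1}`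
if `n` is even (just `1` if `n = 0`) and the one-by-one block `conj b` if `n` is odd. The
two-by-two block with number `k ≥ 1` occupies the positions `2 k - 1` and `2 k`.
Only `α 0, …, α (n - 1)` are used. -/
def matM (n : ℕ) (α : ℕ → ℂ) (b : ℂ) : Matrix (Fin (n + 1)) (Fin (n + 1)) ℂ :=
  Matrix.of fun i j =>
    if ((i : ℕ) + 1) / 2 = ((j : ℕ) + 1) / 2 then
      if (i : ℕ) = 0 then 1
      else if 2 * (((i : ℕ) + 1) / 2) - 1 = n then conj b
      else theta (α (2 * (((i : ℕ) + 1) / 2) - 1)) (par (i + 1)) (par (j + 1))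
    else 0

/-- The matrix `C(α₀, …, α_{n-1}, b)`, of order `n + 1`. -/
def cmv (n : ℕ) (α : ℕ → ℂ) (b : ℂ) : Matrix (Fin (n + 1)) (Fin (n + 1)) ℂ :=
  matL n α b * matM n α b

/-- `k` steps of the backward recursion for the pseudo-reflection coefficients, starting at
index `n` with the value `b`; the result is the coefficient with index `n - k`. -/
def pseudoSteps (n : ℕ) (α : ℕ → ℂ) (b ζ : ℂ) : ℕ → ℂ
  | 0 => b
  | k + 1 =>
    (conj ζ * α (n - (k + 1)) + pseudoSteps n α b ζ k) /
      (conj (α (n - (k + 1))) * pseudoSteps n α b ζ k + conj ζ)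

/-- The pseudo-reflection coefficient `b_j(ζ)`, for `j ≤ n`. -/
def pseudo (n : ℕ) (α : ℕ → ℂ) (b ζ : ℂ) (j : ℕ) : ℂ := pseudoSteps n α b ζ (n - j)

/-- The number `γ_m`, as a function of `a = α_m` and `c = b_m`. -/
def gam (a c : ℂ) : ℂ := (a - c) / (conj a * c - 1)

/-- The matrix `N = C(α_{m+1}, …, α_{n-1}, b) · diag(γ_m, 1, …, 1)` of order `n - m`,
for `m < n` and `c = b_m`. -/
def matN (n m : ℕ) (α : ℕ → ℂ) (b c : ℂ) :
    Matrix (Fin (n - (m + 1) + 1)) (Fin (n - (m + 1) + 1)) ℂ :=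
  cmv (n - (m + 1)) (fun j => α (m + 1 + j)) b *
    Matrix.diagonal (fun i => if i = 0 then gam (α m) c else 1)

/-- The set `A` of the eigenvalues `ζ` on the unit circle of `C(α₀, …, α_{m-1}, c)` with
`b_m(ζ) = c`. -/
def setA (n m : ℕ) (α : ℕ → ℂ) (b c : ℂ) : Set ℂ :=
  {ζ | ‖ζ‖ = 1 ∧ pseudo n α b ζ m = c} ∩ spectrum ℂ (cmv m α c)

/-- The set `B = σ(N) \ A`. -/
def setB (n m : ℕ) (α : ℕ → ℂ) (b c : ℂ) : Set ℂ :=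
  spectrum ℂ (matN n m α b c) \ setA n m α b c

/-- The open arc of the unit circle that leads counterclockwise from `z` to `w`
(for `z ≠ w` on the unit circle). -/
def openArc (z w : ℂ) : Set ℂ :=
  {x | ∃ s t : ℝ, 0 < s ∧ s < t ∧ t < 2 * Real.pi ∧
    x = z * Complex.exp (s * Complex.I) ∧ w = z * Complex.exp (t * Complex.I)}

/-- Each open arc connecting two distinct elements of `S` contains an element of `T`. (The two
arcs that connect `z` and `w` are the one from `z` to `w` and the one from `w` to `z`.) -/
def Separates (S T : Set ℂ) : Prop :=
  ∀ z ∈ S, ∀ w ∈ S, z ≠ w → ∃ x ∈ T, x ∈ openArc z w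

/-- Two nonempty finite subsets of the unit circle strictly interlace: after the one with fewer
elements is completed by points of the unit circle to a set with as many elements as the other,
each open arc connecting two distinct elements of one of the two sets contains an element of
the other. (The condition on the cardinalities forces the larger set to stay as it is.) -/
def StrictlyInterlace (S T : Set ℂ) : Prop :=
  S.Finite ∧ T.Finite ∧ S.Nonempty ∧ T.Nonempty ∧
    S ⊆ Metric.sphere (0 : ℂ) 1 ∧ T ⊆ Metric.sphere (0 : ℂ) 1 ∧
    ∃ S' T' : Set ℂ, S'.Finite ∧ T'.Finite ∧ S ⊆ S' ∧ T ⊆ T' ∧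
      S' ⊆ Metric.sphere (0 : ℂ) 1 ∧ T' ⊆ Metric.sphere (0 : ℂ) 1 ∧
      S'.ncard = max S.ncard T.ncard ∧ T'.ncard = max S.ncard T.ncard ∧
      Separates S' T' ∧ Separates T' S'

end CMV

end

/-! Every spectrum in question is the fibre over `1` of a map of the unit circle that lifts to a
strictly increasing function on the line; interlacing then becomes a statement about where such
functions take integer values. Put `s_m(ζ) = ζ Φ_m(ζ) / Φ_m^*(ζ)` (`szegoMap`), of degree `m + 1`,
and let `b_m(ζ)` be the pseudo-reflection coefficient, of degree `n - m` if `m < n`. Each is built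
by alternating disk automorphisms, which preserve the degree, with multiplication by `ζ`, which adds
one. A two-term recursion gives an eigenvector whenever `b_n s_n(ζ) = 1`. This fibre has `n + 1`
points, so it is the whole spectrum (`spectrum_cmvDiag`). Transferring one coefficient at a time
turns the condition into `s_m(ζ) b_m(ζ) = 1` for any `m ≤ n` (`pseudo_mul_szegoMap_iff`). (i)
Multiplying the tail by `β` multiplies `b_m(ζ)` by `β`, so the two spectra are distinct fibres of
one map (`strictlyInterlace_fib_const_mul`). (ii) Write `s_m b_m(ζ) = (c s_m) (conj c b_m(ζ))` with
`c = b_m`. The factors have the fibres `σ(C(α₀, …, α_{m-1}, c))` and `σ(N)`, and the fibre of a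
product interlaces with the union of the fibres of its factors, up to common points
(`strictlyInterlace_mul_union`). -/

noncomputable section

namespace CMV

/-! ### Arcs of the unit circle in a real parameter -/

/-- The parametrization `t ↦ exp (2 π i t)` of the unit circle. -/
def ex (t : ℝ) : ℂ := Complex.exp ((2 * Real.pi * t : ℝ) * Complex.I)

lemma ex_add (s t : ℝ) : ex (s + t) = ex s * ex t := by
  simp only [ex, ← Complex.exp_add]; congr 1; push_cast; ring

lemma ex_zero : ex 0 = 1 := by simp [ex]

lemma norm_ex (t : ℝ) : ‖ex t‖ = 1 := Complex.norm_exp_ofReal_mul_I _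

lemma ex_eq_one_iff {t : ℝ} : ex t = 1 ↔ ∃ k : ℤ, t = k := by
  rw [ex, Complex.exp_eq_one_iff]
  refine exists_congr fun k => ?_
  have h : (k : ℂ) * (2 * Real.pi * Complex.I) = ((2 * Real.pi * k : ℝ) : ℂ) * Complex.I := by
    push_cast; ring
  rw [h, mul_left_inj' Complex.I_ne_zero, Complex.ofReal_inj,
    mul_right_inj' Real.two_pi_pos.ne']

lemma ex_int (k : ℤ) : ex k = 1 := ex_eq_one_iff.2 ⟨k, rfl⟩

lemma ex_ne_zero (t : ℝ) : ex t ≠ 0 := Complex.exp_ne_zero _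

lemma ex_eq_iff {s t : ℝ} : ex s = ex t ↔ ∃ k : ℤ, s = t + k := by
  have h : ex s = ex (s - t) * ex t := by rw [← ex_add]; ring_nf
  rw [h, mul_eq_right₀ (ex_ne_zero t), ex_eq_one_iff]
  simp only [sub_eq_iff_eq_add, add_comm]

lemma exists_ex {z : ℂ} (hz : ‖z‖ = 1) : ∃ t, ex t = z := by
  refine ⟨z.arg / (2 * Real.pi), ?_⟩
  rw [ex, mul_div_cancel₀ _ Real.two_pi_pos.ne']
  simpa [hz] using Complex.norm_mul_exp_arg_mul_I z

lemma exists_ex_Ioo {z : ℂ} (hz : ‖z‖ = 1) {t : ℝ} (h : ex t ≠ z) :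
    ∃ s, t < s ∧ s < t + 1 ∧ ex s = z := by
  obtain ⟨s, rfl⟩ := exists_ex hz
  have hk (k : ℤ) : ex (s + k) = ex s := ex_eq_iff.2 ⟨k, rfl⟩
  refine ⟨s + (-⌊s - t⌋ : ℤ), lt_of_le_of_ne ?_ ?_, ?_, hk _⟩
  · push_cast; linarith [Int.floor_le (s - t)]
  · intro h'; exact h (by rw [h', hk])
  · push_cast; linarith [Int.lt_floor_add_one (s - t)]

lemma conj_ex (t : ℝ) : conj (ex t) = ex (-t) := by
  rw [ex, ← Complex.exp_conj, ex]; simp [map_ofNat]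

lemma continuous_ex : Continuous ex := by unfold ex; fun_prop

lemma ex_mem_openArc {t s r : ℝ} (h1 : t < s) (h2 : s < r) (h3 : r < t + 1) :
    ex s ∈ openArc (ex t) (ex r) := by
  have hp := Real.two_pi_pos
  refine ⟨2 * Real.pi * (s - t), 2 * Real.pi * (r - t), ?_, ?_, ?_, ?_, ?_⟩
  · exact mul_pos hp (by linarith)
  · exact mul_lt_mul_of_pos_left (by linarith) hp
  · nlinarith
  · change _ = ex t * ex (s - t); rw [← ex_add]; ring_nf
  · change _ = ex t * ex (r - t); rw [← ex_add]; ring_nf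

/-- The endpoint `w` has a parameter in `(t, t + 1)`, so an arc is the image of an interval shorter
than one period. -/
lemma separates_of_ex {S T : Set ℂ} (hS : ∀ z ∈ S, ‖z‖ = 1)
    (h : ∀ t r, t < r → ex t ∈ S → ex r ∈ S → ∃ s, t < s ∧ s < r ∧ ex s ∈ T) :
    Separates S T := by
  intro z hz w hw hzw
  obtain ⟨t, rfl⟩ := exists_ex (hS z hz)
  obtain ⟨r, h1, h2, rfl⟩ := exists_ex_Ioo (hS w hw) hzw
  obtain ⟨s, h3, h4, h5⟩ := h t r h1 hz hw
  exact ⟨_, h5, ex_mem_openArc h3 h4 h2⟩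

lemma conj_eq_inv {z : ℂ} (hz : ‖z‖ = 1) : conj z = z⁻¹ :=
  (Complex.inv_eq_conj hz).symm

lemma ne_zero_of_norm_eq_one {z : ℂ} (hz : ‖z‖ = 1) : z ≠ 0 := by
  rintro rfl; simp at hz

lemma one_add_mul_ne_zero {a z : ℂ} (ha : ‖a‖ < 1) (hz : ‖z‖ = 1) : 1 + a * z ≠ 0 := by
  intro h
  have : ‖a * z‖ = 1 := by rw [← neg_eq_of_add_eq_zero_right h]; simp
  rw [norm_mul, hz] at this; linarith

/-! ### Circle maps with increasing lifts -/

/-- `g` is a strictly increasing lift of the map `f` of the unit circle, which has degree `d`. -/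
structure IsCircleLift (d : ℕ) (g : ℝ → ℝ) (f : ℂ → ℂ) : Prop where
  cont : Continuous g
  mono : StrictMono g
  deg : ∀ t, g (t + 1) = g t + d
  lift : ∀ t, f (ex t) = ex (g t)

namespace IsCircleLift

variable {d d' : ℕ} {g g' : ℝ → ℝ} {f f' : ℂ → ℂ}

lemma congr (h : IsCircleLift d g f) (hf : ∀ ζ, ‖ζ‖ = 1 → f ζ = f' ζ) : IsCircleLift d g f' :=
  ⟨h.cont, h.mono, h.deg, fun t => by rw [← hf _ (norm_ex t), h.lift]⟩

lemma norm_eq (h : IsCircleLift d g f) {ζ : ℂ} (hζ : ‖ζ‖ = 1) : ‖f ζ‖ = 1 := by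
  obtain ⟨t, rfl⟩ := exists_ex hζ
  rw [h.lift, norm_ex]

lemma deg_pos (h : IsCircleLift d g f) : 0 < d := by
  have h1 := h.mono (zero_lt_one' ℝ)
  have h2 := h.deg 0
  rw [zero_add] at h2
  rw [h2] at h1
  exact_mod_cast (lt_add_iff_pos_right _).1 h1

lemma add_nat (h : IsCircleLift d g f) (t : ℝ) (k : ℕ) : g (t + k) = g t + k * d := by
  induction k with
  | zero => simp
  | succ k ih => push_cast; rw [← add_assoc, h.deg, ih]; ring

lemma add_int (h : IsCircleLift d g f) (t : ℝ) (k : ℤ) : g (t + k) = g t + k * d := by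
  obtain ⟨m, rfl | rfl⟩ := k.eq_nat_or_neg
  · simpa using h.add_nat t m
  · have := h.add_nat (t - m) m
    push_cast
    rw [sub_add_cancel] at this
    rw [this, ← sub_eq_add_neg]; ring

lemma surj (h : IsCircleLift d g f) (c : ℝ) : ∃ t, g t = c := by
  have hd : (1 : ℝ) ≤ d := by exact_mod_cast h.deg_pos
  obtain ⟨k, hk⟩ := exists_nat_ge |c - g 0|
  have hk' := abs_le.1 hk
  have hkd : (k : ℝ) ≤ k * d := le_mul_of_one_le_right (by positivity) hd
  refine mem_range_of_exists_le_of_exists_ge h.cont ⟨0 + (-k : ℤ), ?_⟩ ⟨0 + (k : ℤ), ?_⟩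
  · rw [h.add_int]; push_cast; linarith
  · rw [h.add_int]; push_cast; linarith

lemma eq_one_iff (h : IsCircleLift d g f) (t : ℝ) : f (ex t) = 1 ↔ ∃ k : ℤ, g t = k := by
  rw [h.lift, ex_eq_one_iff]

lemma const_mul (h : IsCircleLift d g f) (θ : ℝ) :
    IsCircleLift d (fun t => θ + g t) (fun ζ => ex θ * f ζ) :=
  ⟨continuous_const.add h.cont, h.mono.const_add θ, fun t => by rw [h.deg]; ring,
    fun t => by rw [h.lift, ex_add]⟩

lemma mul (h : IsCircleLift d g f) (h' : IsCircleLift d' g' f') :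
    IsCircleLift (d + d') (fun t => g t + g' t) (fun ζ => f ζ * f' ζ) :=
  ⟨h.cont.add h'.cont, h.mono.add h'.mono, fun t => by rw [h.deg, h'.deg]; push_cast; ring,
    fun t => by rw [h.lift, h'.lift, ex_add]⟩

end IsCircleLift

lemma isCircleLift_id : IsCircleLift 1 (fun t => t) (fun ζ => ζ) :=
  ⟨continuous_id, strictMono_id, fun t => by simp, fun _ => rfl⟩

/-! ### Lifts of disk automorphisms -/

/-- The disk automorphism `z ↦ (z + a) / (1 + conj a * z)`. -/
def mob (a z : ℂ) : ℂ := (z + a) / (1 + conj a * z)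

lemma mob_injOn {a z w : ℂ} (ha : ‖a‖ < 1) (hz : ‖z‖ = 1) (hw : ‖w‖ = 1)
    (h : mob a z = mob a w) : z = w := by
  have ha' : ‖conj a‖ < 1 := by simpa using ha
  rw [mob, mob, div_eq_div_iff (one_add_mul_ne_zero ha' hz) (one_add_mul_ne_zero ha' hw)] at h
  have h1 : (1 - conj a * a) * (z - w) = 0 := by linear_combination h
  refine sub_eq_zero.1 ((mul_eq_zero.1 h1).resolve_left fun h2 => ?_)
  have h3 : ‖conj a * a‖ = 1 := by rw [← sub_eq_zero.1 h2]; simp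
  rw [norm_mul, RCLike.norm_conj] at h3
  nlinarith [norm_nonneg a]

/-- The lift of `mob a`. -/
def mobLift (a : ℂ) (s : ℝ) : ℝ := s + (1 + a * ex (-s)).arg / Real.pi

lemma one_add_mem_slitPlane {a : ℂ} (ha : ‖a‖ < 1) (s : ℝ) :
    1 + a * ex s ∈ Complex.slitPlane := by
  left
  have h1 : ‖a * ex s‖ < 1 := by rwa [norm_mul, norm_ex, mul_one]
  have h2 := (abs_lt.1 ((Complex.abs_re_le_norm _).trans_lt h1)).1
  rw [Complex.add_re, Complex.one_re]; linarith

/-- For `|z| = 1` and `w = 1 + a * conj z`, the numerator is `z w` and the denominator is `conj w`.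
Hence the value is `z` rotated by twice the argument of `w`, which is `arg w / π` in units of a full
turn. -/
lemma mob_ex {a : ℂ} (ha : ‖a‖ < 1) (s : ℝ) : mob a (ex s) = ex (mobLift a s) := by
  set w := 1 + a * ex (-s) with hw
  have hw0 : w ≠ 0 := Complex.slitPlane_ne_zero (one_add_mem_slitPlane ha (-s))
  have hcw : conj w = 1 + conj a * ex s := by simp [hw, conj_ex]
  have he : ex s * ex (-s) = 1 := by rw [← ex_add]; simp [ex_zero]
  have h1 : ex s + a = ex s * w := by rw [hw]; linear_combination (-a) * he
  have h2 : ex (w.arg / Real.pi) =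
      Complex.exp (w.arg * Complex.I) * Complex.exp (w.arg * Complex.I) := by
    rw [ex, ← Complex.exp_add]
    congr 1
    have : 2 * Real.pi * (w.arg / Real.pi) = w.arg + w.arg := by
      field_simp [Real.pi_pos.ne']; ring
    rw [this]; push_cast; ring
  have h3 := Complex.norm_mul_exp_arg_mul_I w
  have h4 : conj w * Complex.exp (w.arg * Complex.I) = ‖w‖ := by
    have h5 : (‖w‖ : ℂ) * conj w * Complex.exp (w.arg * Complex.I) = ‖w‖ * ‖w‖ := by
      have := Complex.conj_mul' w
      linear_combination conj w * h3 + this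
    have h6 : (‖w‖ : ℂ) ≠ 0 := by simpa using hw0
    exact mul_left_cancel₀ h6 (by rw [← h5]; ring)
  have hcw0 : conj w ≠ 0 := by simpa using hw0
  rw [mob, h1, ← hcw, mobLift, ex_add, h2, div_eq_iff hcw0]
  linear_combination (-ex s) * h3 - ex s * Complex.exp (w.arg * Complex.I) * h4

lemma mobLift_add_int (a : ℂ) (s : ℝ) (k : ℤ) : mobLift a (s + k) = mobLift a s + k := by
  have : ex (-(s + k)) = ex (-s) := ex_eq_iff.2 ⟨-k, by push_cast; ring⟩
  rw [mobLift, mobLift, this]; ring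

lemma continuous_mobLift {a : ℂ} (ha : ‖a‖ < 1) : Continuous (mobLift a) := by
  refine continuous_id.add (Continuous.div_const ?_ _)
  rw [continuous_iff_continuousAt]
  intro s
  exact (Complex.continuousAt_arg (one_add_mem_slitPlane ha (-s))).comp
    (f := fun s : ℝ => 1 + a * ex (-s))
    (continuous_const.add (continuous_const.mul (continuous_ex.comp continuous_neg))).continuousAt

/-- No derivative is needed: a continuous injective function on the line is strictly monotone, and
`mobLift a 1 = mobLift a 0 + 1` excludes the decreasing case. -/
lemma strictMono_mobLift {a : ℂ} (ha : ‖a‖ < 1) : StrictMono (mobLift a) := by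
  have hinj : Function.Injective (mobLift a) := by
    intro s t hst
    have h1 : ex s = ex t :=
      mob_injOn ha (norm_ex s) (norm_ex t) (by rw [mob_ex ha, mob_ex ha, hst])
    obtain ⟨k, rfl⟩ := ex_eq_iff.1 h1
    rw [mobLift_add_int] at hst
    linarith
  refine ((continuous_mobLift ha).strictMono_of_inj hinj).resolve_right fun h => ?_
  have h1 := h (zero_lt_one' ℝ)
  have h2 := mobLift_add_int a 0 1
  norm_num at h2
  linarith

lemma IsCircleLift.mob {d : ℕ} {g : ℝ → ℝ} {f : ℂ → ℂ} (h : IsCircleLift d g f) {a : ℂ}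
    (ha : ‖a‖ < 1) : IsCircleLift d (fun t => mobLift a (g t)) (fun ζ => mob a (f ζ)) :=
  ⟨(continuous_mobLift ha).comp h.cont, (strictMono_mobLift ha).comp h.mono,
    fun t => by rw [h.deg]; exact_mod_cast mobLift_add_int a (g t) d,
    fun t => by rw [h.lift, mob_ex ha]⟩

/-! ### Fibres and their interlacing -/

/-- The fibre over `1` of a map on the unit circle. -/
def fib (f : ℂ → ℂ) : Set ℂ := {ζ | ‖ζ‖ = 1 ∧ f ζ = 1}

section fibre

variable {d d' : ℕ} {g g' : ℝ → ℝ} {f f' : ℂ → ℂ}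

lemma ex_mem_fib (h : IsCircleLift d g f) {t : ℝ} : ex t ∈ fib f ↔ ∃ k : ℤ, g t = k := by
  simp [fib, norm_ex, h.eq_one_iff]

/-- Over one period the lift grows by `d`, so it meets each residue class of integers modulo `d`
once; the points with `g = 0, …, d - 1` represent the fibre. -/
lemma encard_fib (h : IsCircleLift d g f) : (fib f).encard = d := by
  choose τ hτ using fun k : ℕ => h.surj k
  have hd := h.deg_pos
  have himg : fib f = (fun k => ex (τ k)) '' (Finset.range d : Set ℕ) := by
    ext ζ
    constructor
    · rintro hζ
      obtain ⟨t, rfl⟩ := exists_ex hζ.1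
      obtain ⟨k, hk⟩ := (ex_mem_fib h).1 hζ
      have hd0 : (d : ℤ) ≠ 0 := by exact_mod_cast hd.ne'
      obtain ⟨r, hr⟩ := Int.eq_ofNat_of_zero_le (Int.emod_nonneg k hd0)
      have hrd : r < d := by
        have := Int.emod_lt_of_pos k (b := d) (by exact_mod_cast hd)
        rw [hr] at this; exact_mod_cast this
      refine ⟨r, by simpa using hrd, ?_⟩
      refine ex_eq_iff.2 ⟨-(k / d), h.mono.injective ?_⟩
      rw [h.add_int, hτ, hk]
      have := Int.emod_add_mul_ediv k d
      rw [hr] at this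
      have h' : (r : ℝ) + d * ((k / d : ℤ) : ℝ) = k := by exact_mod_cast this
      push_cast at *
      linarith
    · rintro ⟨k, -, rfl⟩
      exact (ex_mem_fib h).2 ⟨k, by rw [hτ]; simp⟩
  rw [himg, Set.InjOn.encard_image, Set.encard_coe_eq_coe_finsetCard, Finset.card_range]
  intro i hi j hj hij
  obtain ⟨k, hk⟩ := ex_eq_iff.1 hij
  have h1 : (i : ℝ) = j + k * d := by rw [← hτ i, hk, h.add_int, hτ]
  have h2 : (i : ℤ) = j + k * d := by exact_mod_cast h1
  simp only [Finset.coe_range, Set.mem_Iio] at hi hj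
  have h3 : k = 0 := by
    by_contra hk0
    rcases lt_or_gt_of_ne hk0 with hk1 | hk1 <;> nlinarith
  subst h3
  simpa using h2

lemma finite_fib (h : IsCircleLift d g f) : (fib f).Finite :=
  Set.finite_of_encard_eq_coe (encard_fib h)

lemma nonempty_fib (h : IsCircleLift d g f) : (fib f).Nonempty := by
  rw [← Set.encard_ne_zero, encard_fib h]
  exact_mod_cast h.deg_pos.ne'

/-- With equal cardinalities no completion is needed. This is the case in both parts of the theorem.
-/
lemma StrictlyInterlace.of_separates {S T : Set ℂ} (hS : S.Finite) (hT : T.Finite)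
    (hS' : S.Nonempty) (hT' : T.Nonempty) (hS1 : ∀ z ∈ S, ‖z‖ = 1) (hT1 : ∀ z ∈ T, ‖z‖ = 1)
    (hc : S.ncard = T.ncard) (h1 : Separates S T) (h2 : Separates T S) :
    StrictlyInterlace S T := by
  have hS2 : S ⊆ Metric.sphere (0 : ℂ) 1 := fun z hz => by simpa using hS1 z hz
  have hT2 : T ⊆ Metric.sphere (0 : ℂ) 1 := fun z hz => by simpa using hT1 z hz
  exact ⟨hS, hT, hS', hT', hS2, hT2, S, T, hS, hT, le_rfl, le_rfl, hS2, hT2, by simp [hc],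
    by simp [hc], h1, h2⟩

lemma separates_fib_of_sub_const (h : IsCircleLift d g f) {θ : ℝ} (hθ : ∀ k : ℤ, θ ≠ k)
    (h' : IsCircleLift d (fun t => θ + g t) f') : Separates (fib f) (fib f') := by
  refine separates_of_ex (fun z hz => hz.1) fun t r htr ht hr => ?_
  obtain ⟨j, hj⟩ := (ex_mem_fib h).1 ht
  obtain ⟨l, hl⟩ := (ex_mem_fib h).1 hr
  have hjl : (j : ℝ) + 1 ≤ l := by
    have := h.mono htr
    rw [hj, hl] at this
    have : j < l := by exact_mod_cast this
    exact_mod_cast this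
  -- Here `g s = j + (⌊θ⌋ + 1 - θ)`, which lies strictly between `j` and `j + 1` because `θ` is not
  -- an integer.
  obtain ⟨s, hs⟩ := h'.surj ((⌊θ⌋ + j + 1 : ℤ) : ℝ)
  have h1 := Int.lt_floor_add_one θ
  have h2 := (Int.floor_le θ).lt_of_ne (hθ _).symm
  have hs' : θ + g s = ⌊θ⌋ + j + 1 := by simpa using hs
  refine ⟨s, h.mono.lt_iff_lt.1 ?_, h.mono.lt_iff_lt.1 ?_, (ex_mem_fib h').2 ⟨_, hs⟩⟩ <;> linarith

/-- Two distinct fibres of a map with an increasing lift interlace strictly. -/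
lemma strictlyInterlace_fib_const_mul (h : IsCircleLift d g f) {β : ℂ} (hβ : ‖β‖ = 1)
    (hβ1 : β ≠ 1) : StrictlyInterlace (fib f) (fib fun ζ => β * f ζ) := by
  obtain ⟨θ, rfl⟩ := exists_ex hβ
  have hθ : ∀ k : ℤ, θ ≠ k := fun k hk => hβ1 (ex_eq_one_iff.2 ⟨k, hk⟩)
  have h' := h.const_mul θ
  refine .of_separates (finite_fib h) (finite_fib h') (nonempty_fib h) (nonempty_fib h')
    (fun z hz => hz.1) (fun z hz => hz.1) ?_ (separates_fib_of_sub_const h hθ h')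
    (separates_fib_of_sub_const (θ := -θ) h' (fun k hk => hθ (-k) (by push_cast; linarith)) ?_)
  · rw [Set.ncard, encard_fib h, Set.ncard, encard_fib h']
  · simpa using h

lemma inter_fib_subset_mul : fib f ∩ fib f' ⊆ fib fun ζ => f ζ * f' ζ :=
  fun ζ hζ => ⟨hζ.1.1, by simp [hζ.1.2, hζ.2.2]⟩

lemma separates_union_mul (h : IsCircleLift d g f) (h' : IsCircleLift d' g' f') :
    Separates (fib f ∪ fib f') ((fib fun ζ => f ζ * f' ζ) \ (fib f ∩ fib f')) := by
  have hm := h.mul h'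
  refine separates_of_ex (fun z hz => hz.elim (·.1) (·.1)) fun t r htr ht hr => ?_
  -- At `t` one summand is an integer, so `g + g'` is still below this target. By `r` that summand
  -- or the other has reached its next integer, so the target has been passed. At a common point of
  -- the fibres both would have reached their next integers, which overshoots the target.
  obtain ⟨s, hs⟩ := hm.surj ((⌊g t⌋ + ⌊g' t⌋ + 1 : ℤ) : ℝ)
  have hs' : g s + g' s = ⌊g t⌋ + ⌊g' t⌋ + 1 := by simpa using hs
  have step (x : ℝ) (k : ℤ) (hx : g t < x) (hk : x = k) : (⌊g t⌋ : ℝ) + 1 ≤ x := by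
    subst hk; exact_mod_cast Int.floor_lt.2 hx
  have step' (x : ℝ) (k : ℤ) (hx : g' t < x) (hk : x = k) : (⌊g' t⌋ : ℝ) + 1 ≤ x := by
    subst hk; exact_mod_cast Int.floor_lt.2 hx
  have f1 := Int.floor_le (g t)
  have f2 := Int.floor_le (g' t)
  have f3 := Int.lt_floor_add_one (g t)
  have f4 := Int.lt_floor_add_one (g' t)
  have hts : t < s := by
    refine hm.mono.lt_iff_lt.1 ?_
    rcases ht with ht | ht
    · obtain ⟨k, hk⟩ := (ex_mem_fib h).1 ht
      have : (⌊g t⌋ : ℝ) = g t := by simp [hk]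
      linarith
    · obtain ⟨k, hk⟩ := (ex_mem_fib h').1 ht
      have : (⌊g' t⌋ : ℝ) = g' t := by simp [hk]
      linarith
  refine ⟨s, hts, ?_, (ex_mem_fib hm).2 ⟨_, hs⟩, ?_⟩
  · refine hm.mono.lt_iff_lt.1 ?_
    have g1 := h.mono htr
    have g2 := h'.mono htr
    rcases hr with hr | hr
    · obtain ⟨k, hk⟩ := (ex_mem_fib h).1 hr
      have := step _ k g1 hk
      linarith
    · obtain ⟨k, hk⟩ := (ex_mem_fib h').1 hr
      have := step' _ k g2 hk
      linarith
  · rintro ⟨hsf, -⟩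
    obtain ⟨k, hk⟩ := (ex_mem_fib h).1 hsf
    have := step _ k (h.mono hts) hk
    linarith [h'.mono hts]

lemma separates_mul_union (h : IsCircleLift d g f) (h' : IsCircleLift d' g' f') :
    Separates ((fib fun ζ => f ζ * f' ζ) \ (fib f ∩ fib f')) (fib f ∪ fib f') := by
  have hm := h.mul h'
  refine separates_of_ex (fun z hz => hz.1.1) fun t r htr ht hr => ?_
  -- If `f = 1` at a point where the product is `1`, then `f' = 1` too; so off the common points `g`
  -- is not an integer.
  have nf (x : ℝ) (hx : ex x ∈ (fib fun ζ => f ζ * f' ζ) \ (fib f ∩ fib f')) :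
      (∃ j : ℤ, g x + g' x = j) ∧ (∀ k : ℤ, g x ≠ k) := by
    refine ⟨(ex_mem_fib hm).1 hx.1, fun k hk => hx.2 ?_⟩
    have h1 : ex x ∈ fib f := (ex_mem_fib h).2 ⟨k, hk⟩
    exact ⟨h1, hx.1.1, by simpa [h1.2] using hx.1.2⟩
  obtain ⟨⟨j, hj⟩, ht'⟩ := nf t ht
  obtain ⟨⟨l, hl⟩, hr'⟩ := nf r hr
  have f1 := (Int.floor_le (g t)).lt_of_ne (ht' _).symm
  have f3 := Int.lt_floor_add_one (g t)
  set k := ⌊g t⌋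
  have hjl : (j : ℝ) + 1 ≤ l := by
    have := hm.mono htr
    simp only [hj, hl] at this
    have : j < l := by exact_mod_cast this
    exact_mod_cast this
  -- The next integers above `g t` and `g' t` are `k + 1` and `j - k`. If neither is reached before
  -- `r`, then `g r + g' r ≤ j + 1 ≤ l` forces `g r = k + 1`, which is excluded.
  obtain ⟨s, hs⟩ := h.surj ((k + 1 : ℤ) : ℝ)
  obtain ⟨s', hs'⟩ := h'.surj ((j - k : ℤ) : ℝ)
  by_cases h1 : s < r
  · refine ⟨s, h.mono.lt_iff_lt.1 ?_, h1, Or.inl ((ex_mem_fib h).2 ⟨_, hs⟩)⟩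
    rw [hs]; push_cast; linarith
  by_cases h2 : s' < r
  · refine ⟨s', h'.mono.lt_iff_lt.1 ?_, h2, Or.inr ((ex_mem_fib h').2 ⟨_, hs'⟩)⟩
    rw [hs']; push_cast; linarith
  have g1 := h.mono.monotone (not_lt.1 h1)
  have g2 := h'.mono.monotone (not_lt.1 h2)
  rw [hs] at g1
  rw [hs'] at g2
  refine absurd ?_ (hr' (k + 1))
  push_cast at g1 g2 ⊢
  linarith

/-- For two maps of the unit circle with increasing lifts, the fibre of the product and the union
of the fibres interlace strictly, up to the common points. -/
lemma strictlyInterlace_mul_union (h : IsCircleLift d g f) (h' : IsCircleLift d' g' f') :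
    StrictlyInterlace ((fib fun ζ => f ζ * f' ζ) \ (fib f ∩ fib f')) (fib f ∪ fib f') := by
  have hm := h.mul h'
  have hS := finite_fib hm
  have hf := finite_fib h
  have hf' := finite_fib h'
  have c1 : (fib f).ncard = d := by rw [Set.ncard, encard_fib h]; rfl
  have c2 : (fib f').ncard = d' := by rw [Set.ncard, encard_fib h']; rfl
  have c3 : (fib fun ζ => f ζ * f' ζ).ncard = d + d' := by rw [Set.ncard, encard_fib hm]; rfl
  have c4 := Set.ncard_union_add_ncard_inter (fib f) (fib f') hf hf'
  have c5 := Set.ncard_sdiff_add_ncard_of_subset (inter_fib_subset_mul (f := f) (f' := f')) hS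
  -- Both sides equal `d + d'` minus the number of common points.
  have hc : ((fib fun ζ => f ζ * f' ζ) \ (fib f ∩ fib f')).ncard = (fib f ∪ fib f').ncard := by
    omega
  have hT := (nonempty_fib h).mono (Set.subset_union_left (t := fib f'))
  refine .of_separates hS.sdiff (hf.union hf') ?_ hT
    (fun z hz => hz.1.1) (fun z hz => hz.elim (·.1) (·.1)) hc (separates_mul_union h h')
    (separates_union_mul h h')
  exact Set.nonempty_of_ncard_ne_zero (hc ▸ (Set.ncard_pos (hf.union hf')).2 hT |>.ne')

end fibre

/-! ### Rows of the block diagonal factors -/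

open Matrix

section blocks

variable {n k : ℕ} {α : ℕ → ℂ} {b : ℂ} {v : ℕ → ℂ} {i : Fin (n + 1)}

lemma matL_mulVec_last (hi : (i : ℕ) = 2 * k) (hn : n = 2 * k) :
    (matL n α b *ᵥ fun j => v j) i = conj b * v (2 * k) := by
  rw [mulVec, dotProduct, Fintype.sum_eq_single i]
  · simp [matL, hi, hn]
  · intro j hj
    have hj' : (j : ℕ) ≠ i := fun h => hj (Fin.ext h)
    have : ¬ (i : ℕ) / 2 = (j : ℕ) / 2 := by omega
    simp [matL, this]

lemma matL_mulVec_even (hi : (i : ℕ) = 2 * k) (hn : 2 * k < n) :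
    (matL n α b *ᵥ fun j => v j) i =
      conj (α (2 * k)) * v (2 * k) + rho (α (2 * k)) * v (2 * k + 1) := by
  rw [mulVec, dotProduct, Fintype.sum_eq_add i ⟨2 * k + 1, by omega⟩]
  · have h1 : (2 * k + 1) / 2 = k := by omega
    simp [matL, hi, hn.ne, h1, theta, par, Nat.add_mod]
  · simp [Fin.ext_iff, hi]
  · rintro j ⟨h1, h2⟩
    simp only [ne_eq, Fin.ext_iff] at h1 h2
    have : ¬ (i : ℕ) / 2 = (j : ℕ) / 2 := by omega
    simp [matL, this]

lemma matL_mulVec_odd (hi : (i : ℕ) = 2 * k + 1) :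
    (matL n α b *ᵥ fun j => v j) i =
      rho (α (2 * k)) * v (2 * k) - α (2 * k) * v (2 * k + 1) := by
  have hin := i.isLt
  rw [mulVec, dotProduct, Fintype.sum_eq_add ⟨2 * k, by omega⟩ i]
  · have h1 : (2 * k + 1) / 2 = k := by omega
    have h2 : 2 * k ≠ n := by omega
    simp [matL, hi, h1, h2, theta, par, Nat.add_mod, sub_eq_add_neg]
  · simp [Fin.ext_iff, hi]
  · rintro j ⟨h1, h2⟩
    simp only [ne_eq, Fin.ext_iff] at h1 h2
    have : ¬ (i : ℕ) / 2 = (j : ℕ) / 2 := by omega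
    simp [matL, this]

lemma matM_mulVec_zero (hi : (i : ℕ) = 0) :
    (matM n α b *ᵥ fun j => v j) i = v 0 := by
  rw [mulVec, dotProduct, Fintype.sum_eq_single i]
  · obtain rfl : i = 0 := Fin.ext hi
    simp [matM]
  · intro j hj
    have hj' : (j : ℕ) ≠ i := fun h => hj (Fin.ext h)
    have : ¬ ((i : ℕ) + 1) / 2 = ((j : ℕ) + 1) / 2 := by omega
    simp [matM, this]

lemma matM_mulVec_last (hi : (i : ℕ) = 2 * k + 1) (hn : n = 2 * k + 1) :
    (matM n α b *ᵥ fun j => v j) i = conj b * v (2 * k + 1) := by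
  rw [mulVec, dotProduct, Fintype.sum_eq_single i]
  · have h1 : (2 * k + 1 + 1) / 2 = k + 1 := by omega
    have h2 : 2 * (k + 1) - 1 = n := by omega
    have hi0 : i ≠ 0 := fun h => by simp [h] at hi
    simp [matM, hi, hi0, h1, h2]
  · intro j hj
    have hj' : (j : ℕ) ≠ i := fun h => hj (Fin.ext h)
    have : ¬ ((i : ℕ) + 1) / 2 = ((j : ℕ) + 1) / 2 := by omega
    simp [matM, this]

lemma matM_mulVec_odd (hi : (i : ℕ) = 2 * k + 1) (hn : 2 * k + 1 < n) :
    (matM n α b *ᵥ fun j => v j) i =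
      conj (α (2 * k + 1)) * v (2 * k + 1) + rho (α (2 * k + 1)) * v (2 * k + 2) := by
  rw [mulVec, dotProduct, Fintype.sum_eq_add i ⟨2 * k + 2, by omega⟩]
  · have h1 : (2 * k + 1 + 1) / 2 = k + 1 := by omega
    have h2 : (2 * k + 2 + 1) / 2 = k + 1 := by omega
    have h3 : 2 * (k + 1) - 1 = 2 * k + 1 := by omega
    have h4 : (2 * k + 1 + 1) % 2 = 0 := by omega
    have h5 : (2 * k + 2 + 1) % 2 = 1 := by omega
    have hi0 : i ≠ 0 := fun h => by simp [h] at hi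
    simp [matM, hi, hi0, hn.ne, h1, h2, h3, h4, h5, theta, par]
  · simp [Fin.ext_iff, hi]
  · rintro j ⟨h1, h2⟩
    simp only [ne_eq, Fin.ext_iff] at h1 h2
    have : ¬ ((i : ℕ) + 1) / 2 = ((j : ℕ) + 1) / 2 := by omega
    simp [matM, this]

lemma matM_mulVec_even (hi : (i : ℕ) = 2 * k + 2) :
    (matM n α b *ᵥ fun j => v j) i =
      rho (α (2 * k + 1)) * v (2 * k + 1) - α (2 * k + 1) * v (2 * k + 2) := by
  have hin := i.isLt
  rw [mulVec, dotProduct, Fintype.sum_eq_add ⟨2 * k + 1, by omega⟩ i]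
  · have h1 : (2 * k + 1 + 1) / 2 = k + 1 := by omega
    have h2 : (2 * k + 2 + 1) / 2 = k + 1 := by omega
    have h3 : 2 * (k + 1) - 1 = 2 * k + 1 := by omega
    have h4 : (2 * k + 1 + 1) % 2 = 0 := by omega
    have h5 : (2 * k + 2 + 1) % 2 = 1 := by omega
    have h6 : 2 * k + 1 ≠ n := by omega
    have hi0 : i ≠ 0 := fun h => by simp [h] at hi
    simp [matM, hi, hi0, h1, h2, h3, h4, h5, h6, theta, par, sub_eq_add_neg]
  · simp [Fin.ext_iff, hi]
  · rintro j ⟨h1, h2⟩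
    simp only [ne_eq, Fin.ext_iff] at h1 h2
    have : ¬ ((i : ℕ) + 1) / 2 = ((j : ℕ) + 1) / 2 := by omega
    simp [matM, this]

end blocks

lemma rho_mul_self {a : ℂ} (ha : ‖a‖ < 1) : rho a * rho a = 1 - conj a * a := by
  have h : 0 ≤ 1 - ‖a‖ ^ 2 := by nlinarith [norm_nonneg a]
  rw [rho, ← Complex.ofReal_mul, Real.mul_self_sqrt h, Complex.conj_mul']
  push_cast; ring

lemma rho_ne_zero {a : ℂ} (ha : ‖a‖ < 1) : rho a ≠ 0 := by
  have h : 0 < 1 - ‖a‖ ^ 2 := by nlinarith [norm_nonneg a]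
  rw [rho]; exact_mod_cast (Real.sqrt_pos.2 h).ne'

/-! ### The Szegő recursion and eigenvectors -/

/-- The values `z Φ_k(z) / Φ_k^*(z)` for the monic orthogonal polynomials `Φ_k` on the unit circle
with Verblunsky coefficients `α`, multiplied at the start by the number `c`. -/
def szegoMap (α : ℕ → ℂ) (c : ℂ) : ℕ → ℂ → ℂ
  | 0, ζ => ζ * c
  | k + 1, ζ => ζ * mob (-conj (α k)) (szegoMap α c k ζ)

lemma exists_lift_szegoMap {α : ℕ → ℂ} {c : ℂ} (hc : ‖c‖ = 1) (k : ℕ)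
    (hα : ∀ j < k, ‖α j‖ < 1) : ∃ g, IsCircleLift (k + 1) g (szegoMap α c k) := by
  induction k with
  | zero =>
    obtain ⟨θ, rfl⟩ := exists_ex hc
    exact ⟨_, (isCircleLift_id.const_mul θ).congr fun ζ _ => mul_comm _ _⟩
  | succ k ih =>
    obtain ⟨g, hg⟩ := ih fun j hj => hα j (hj.trans k.lt_succ_self)
    have h := isCircleLift_id.mul (hg.mob (a := -conj (α k)) (by simpa using hα k k.lt_succ_self))
    rw [add_comm 1] at h
    exact ⟨_, h⟩

/-- The components `x j` and `y j` of a vector `x` with `M D x = y` and `L y = ζ x`, where `D` is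
the diagonal matrix with entries `c, 1, …, 1`. -/
def eigPair (α : ℕ → ℂ) (c ζ : ℂ) : ℕ → ℂ × ℂ
  | 0 => (1, c)
  | j + 1 =>
    let p := eigPair α c ζ j
    if j % 2 = 0 then
      ((conj ζ * p.2 - α j * p.1) / rho (α j), (ζ * p.1 - conj (α j) * p.2) / rho (α j))
    else ((p.2 - conj (α j) * p.1) / rho (α j), (p.1 - α j * p.2) / rho (α j))

section eigenvector

variable {α : ℕ → ℂ} {c ζ : ℂ} {k : ℕ}

lemma eigPair_odd : eigPair α c ζ (2 * k + 1) =
    ((conj ζ * (eigPair α c ζ (2 * k)).2 - α (2 * k) * (eigPair α c ζ (2 * k)).1) /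
        rho (α (2 * k)),
      (ζ * (eigPair α c ζ (2 * k)).1 - conj (α (2 * k)) * (eigPair α c ζ (2 * k)).2) /
        rho (α (2 * k))) := by
  rw [eigPair]; simp

lemma eigPair_even : eigPair α c ζ (2 * k + 2) =
    (((eigPair α c ζ (2 * k + 1)).2 - conj (α (2 * k + 1)) * (eigPair α c ζ (2 * k + 1)).1) /
        rho (α (2 * k + 1)),
      ((eigPair α c ζ (2 * k + 1)).1 - α (2 * k + 1) * (eigPair α c ζ (2 * k + 1)).2) /
        rho (α (2 * k + 1))) := by
  rw [eigPair]
  have : (2 * k + 1) % 2 = 1 := by omega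
  simp [this]

lemma conj_mul_self_of_norm {z : ℂ} (hz : ‖z‖ = 1) : conj z * z = 1 := by
  rw [Complex.conj_mul', hz]; simp

/-- The ratio of the two components follows the Szegő recursion. Numerator and denominator swap at
each step, as the blocks alternate between the two factors. The product form avoids dividing by a
component. -/
lemma eigPair_ratio (hc : ‖c‖ = 1) (hζ : ‖ζ‖ = 1) (k : ℕ) (hα : ∀ j < k, ‖α j‖ < 1) :
    (k % 2 = 0 → ζ * (eigPair α c ζ k).1 = szegoMap α (conj c) k ζ * (eigPair α c ζ k).2) ∧
    (k % 2 = 1 → (eigPair α c ζ k).2 = szegoMap α (conj c) k ζ * (eigPair α c ζ k).1) := by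
  have hζ' := conj_mul_self_of_norm hζ
  induction k with
  | zero =>
    refine ⟨fun _ => ?_, by simp⟩
    simp only [eigPair, szegoMap]
    linear_combination (-ζ) * conj_mul_self_of_norm hc
  | succ k ih =>
    have hα' : ∀ j < k, ‖α j‖ < 1 := fun j hj => hα j (hj.trans k.lt_succ_self)
    have hk := hα k k.lt_succ_self
    obtain ⟨g, hg⟩ := exists_lift_szegoMap (c := conj c) (by simpa using hc) k hα'
    have hh := hg.norm_eq hζ
    have hρ := rho_ne_zero hk
    specialize ih hα'
    have hden : 1 - szegoMap α (conj c) k ζ * α k ≠ 0 := by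
      have := one_add_mul_ne_zero (a := -α k) (by simpa using hk) hh
      rwa [neg_mul, ← sub_eq_add_neg, mul_comm] at this
    have hs : szegoMap α (conj c) (k + 1) ζ =
        ζ * ((szegoMap α (conj c) k ζ - conj (α k)) / (1 - szegoMap α (conj c) k ζ * α k)) := by
      rw [szegoMap, mob, map_neg, Complex.conj_conj]; ring_nf
    rw [hs]
    set h := szegoMap α (conj c) k ζ
    constructor
    · intro hk2
      obtain ⟨i, rfl⟩ : ∃ i, k = 2 * i + 1 := ⟨k / 2, by omega⟩
      have e := ih.2 (by omega)
      rw [eigPair_even]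
      simp only []
      rw [e]
      field_simp
    · intro hk2
      obtain ⟨i, rfl⟩ : ∃ i, k = 2 * i := ⟨k / 2, by omega⟩
      have e := ih.1 (by omega)
      have e' : (eigPair α c ζ (2 * i)).1 = conj ζ * (h * (eigPair α c ζ (2 * i)).2) := by
        rw [← e]; linear_combination (-(eigPair α c ζ (2 * i)).1) * hζ'
      rw [eigPair_odd]
      simp only []
      rw [e, e']
      field_simp
      linear_combination (conj (α (2 * i)) - h) * (eigPair α c ζ (2 * i)).2 * hζ'

/-- The matrix `C(α₀, …, α_{n-1}, b) · diag(c, 1, …, 1)`. -/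
def cmvDiag (n : ℕ) (α : ℕ → ℂ) (b c : ℂ) : Matrix (Fin (n + 1)) (Fin (n + 1)) ℂ :=
  cmv n α b * Matrix.diagonal fun i => if i = 0 then c else 1

/-- The recursion `eigPair` solves all rows but the last one for any `ζ` on the circle. The last
row, in the factor that holds `conj b`, is the hypothesis `h` by `eigPair_ratio`. -/
lemma mem_spectrum_cmvDiag {n : ℕ} (hα : ∀ j < n, ‖α j‖ < 1) {b : ℂ}
    (hc : ‖c‖ = 1) (hζ : ‖ζ‖ = 1) (h : szegoMap α (conj c) n ζ = conj b) :
    ζ ∈ spectrum ℂ (cmvDiag n α b c) := by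
  have hr := eigPair_ratio hc hζ n hα
  rw [h] at hr
  have hζ' := conj_mul_self_of_norm hζ
  set x : ℕ → ℂ := fun j => (eigPair α c ζ j).1 with hx
  set y : ℕ → ℂ := fun j => (eigPair α c ζ j).2 with hy
  set w : ℕ → ℂ := fun j => (if j = 0 then c else 1) * x j with hw
  have hws (j : ℕ) : w (j + 1) = x (j + 1) := by simp [hw]
  have hD : (Matrix.diagonal fun i : Fin (n + 1) => if i = 0 then c else 1) *ᵥ (fun j => x j)
      = fun j : Fin (n + 1) => w j := by
    ext j
    simp [mulVec_diagonal, hw]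
  have hM : matM n α b *ᵥ (fun j : Fin (n + 1) => w j) = fun j : Fin (n + 1) => y j := by
    ext i
    obtain hi | ⟨k, hi⟩ | ⟨k, hi⟩ :
        (i : ℕ) = 0 ∨ (∃ k, (i : ℕ) = 2 * k + 1) ∨ ∃ k, (i : ℕ) = 2 * k + 2 := by
      rcases Nat.even_or_odd' i with ⟨k, hk | hk⟩
      · rcases k with _ | k
        · exact Or.inl hk
        · exact Or.inr (Or.inr ⟨k, hk⟩)
      · exact Or.inr (Or.inl ⟨k, hk⟩)
    · rw [matM_mulVec_zero hi, hi]; simp [hw, hx, hy, eigPair]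
    · rw [hi]
      rcases (show 2 * k + 1 ≤ n by omega).eq_or_lt with hn | hn
      · rw [matM_mulVec_last hi hn.symm, hws, hn]
        exact (hr.2 (by omega)).symm
      · have hρ := rho_ne_zero (hα _ hn)
        rw [matM_mulVec_odd hi hn, hws, hws]
        simp only [hx, hy]
        rw [eigPair_even]
        field_simp
        ring
    · have hk : 2 * k + 1 < n := by omega
      have hρ := rho_ne_zero (hα _ hk)
      have hρ2 := rho_mul_self (hα _ hk)
      rw [matM_mulVec_even hi, hi, hws, hws]
      simp only [hx, hy]
      rw [eigPair_even]
      field_simp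
      linear_combination (eigPair α c ζ (2 * k + 1)).1 * hρ2
  have hL : matL n α b *ᵥ (fun j : Fin (n + 1) => y j) = fun j : Fin (n + 1) => ζ * x j := by
    ext i
    rcases Nat.even_or_odd' i with ⟨k, hi | hi⟩
    · rw [hi]
      rcases (show 2 * k ≤ n by omega).eq_or_lt with hn | hn
      · rw [matL_mulVec_last hi hn.symm, hn]
        exact (hr.1 (by omega)).symm
      · have hρ := rho_ne_zero (hα _ hn)
        rw [matL_mulVec_even hi hn]
        simp only [hx, hy]
        rw [eigPair_odd]
        field_simp
        ring
    · have hk : 2 * k < n := by omega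
      have hρ := rho_ne_zero (hα _ hk)
      have hρ2 := rho_mul_self (hα _ hk)
      rw [matL_mulVec_odd hi, hi]
      simp only [hx, hy]
      rw [eigPair_odd]
      field_simp
      linear_combination (eigPair α c ζ (2 * k)).2 * hρ2 - (eigPair α c ζ (2 * k)).2 * hζ'
  rw [← Matrix.spectrum_toLin', ← Module.End.hasEigenvalue_iff_mem_spectrum]
  refine Module.End.hasEigenvalue_of_hasEigenvector (x := fun j : Fin (n + 1) => x j) ⟨?_, ?_⟩
  · rw [Module.End.mem_eigenspace_iff, Matrix.toLin'_apply, cmvDiag, cmv, Matrix.mul_assoc,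
      ← mulVec_mulVec, ← mulVec_mulVec, hD, hM, hL]
    rfl
  · intro h0
    have := congrFun h0 0
    simp [hx, eigPair] at this

end eigenvector

/-! ### The spectrum as a fibre -/

lemma encard_spectrum_le {n : ℕ} (A : Matrix (Fin n) (Fin n) ℂ) :
    (spectrum ℂ A).encard ≤ n := by
  have h : spectrum ℂ A ⊆ (A.charpoly.roots.toFinset : Set ℂ) := by
    intro r hr
    simpa [A.charpoly_monic.ne_zero] using Matrix.mem_spectrum_iff_isRoot_charpoly.1 hr
  refine (Set.encard_le_encard h).trans ?_
  rw [Set.encard_coe_eq_coe_finsetCard]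
  have h1 := A.charpoly.roots.toFinset_card_le.trans A.charpoly.card_roots'
  rw [Matrix.charpoly_natDegree_eq_dim, Fintype.card_fin] at h1
  exact_mod_cast h1

/-- The fibre lies in the spectrum and has `n + 1` points, as many as a matrix of this order can
have eigenvalues. Thus all eigenvalues are found, without appeal to unitarity. -/
lemma spectrum_cmvDiag {n : ℕ} {α : ℕ → ℂ} (hα : ∀ j < n, ‖α j‖ < 1) {b c : ℂ}
    (hb : ‖b‖ = 1) (hc : ‖c‖ = 1) :
    spectrum ℂ (cmvDiag n α b c) = fib fun ζ => b * szegoMap α (conj c) n ζ := by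
  obtain ⟨g, hg⟩ := exists_lift_szegoMap (c := conj c) (by simpa using hc) n hα
  obtain ⟨θ, rfl⟩ := exists_ex hb
  have hg' := hg.const_mul θ
  refine ((finite_fib hg').eq_of_subset_of_encard_le ?_ ?_).symm
  · rintro ζ ⟨hζ, h⟩
    refine mem_spectrum_cmvDiag hα hc hζ ?_
    linear_combination conj (ex θ) * h - szegoMap α (conj c) n ζ * conj_mul_self_of_norm hb
  · rw [encard_fib hg']
    exact encard_spectrum_le _

/-! ### Pseudo-reflection coefficients -/

section pseudo

variable {n : ℕ} {α : ℕ → ℂ} {b ζ : ℂ}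

lemma pseudo_self : pseudo n α b ζ n = b := by simp [pseudo, pseudoSteps]

lemma pseudo_of_lt {j : ℕ} (hj : j < n) (hζ : ‖ζ‖ = 1) :
    pseudo n α b ζ j = mob (α j) (ζ * pseudo n α b ζ (j + 1)) := by
  have h1 : n - j = n - (j + 1) + 1 := by omega
  have h2 : n - (n - (j + 1) + 1) = j := by omega
  have hζ0 := ne_zero_of_norm_eq_one hζ
  rw [pseudo, h1, pseudoSteps, h2, ← pseudo, mob, conj_eq_inv hζ,
    ← mul_div_mul_left _ _ hζ0]
  congr 1
  · field_simp; ring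
  · field_simp; ring

/-- The factor `ζ` makes the induction start: `pseudo n α b ζ n = b` is constant and has no
increasing lift. -/
lemma exists_lift_mul_pseudo (hα : ∀ j < n, ‖α j‖ < 1) (hb : ‖b‖ = 1) (k : ℕ) (hk : k ≤ n) :
    ∃ g, IsCircleLift (k + 1) g fun ζ => ζ * pseudo n α b ζ (n - k) := by
  induction k with
  | zero =>
    obtain ⟨θ, rfl⟩ := exists_ex hb
    refine ⟨_, (isCircleLift_id.const_mul θ).congr fun ζ _ => ?_⟩
    rw [Nat.sub_zero, pseudo_self, mul_comm]
  | succ k ih =>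
    obtain ⟨g, hg⟩ := ih (by omega)
    have h := isCircleLift_id.mul (hg.mob (hα (n - (k + 1)) (by omega)))
    rw [add_comm 1] at h
    refine ⟨_, h.congr fun ζ hζ => ?_⟩
    rw [pseudo_of_lt (j := n - (k + 1)) (by omega) hζ, show n - (k + 1) + 1 = n - k by omega]

lemma norm_pseudo (hα : ∀ j < n, ‖α j‖ < 1) (hb : ‖b‖ = 1) {j : ℕ} (hj : j ≤ n)
    (hζ : ‖ζ‖ = 1) : ‖pseudo n α b ζ j‖ = 1 := by
  obtain ⟨g, hg⟩ := exists_lift_mul_pseudo hα hb (n - j) (by omega)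
  have := hg.norm_eq hζ
  rwa [norm_mul, hζ, one_mul, show n - (n - j) = j by omega] at this

lemma exists_lift_pseudo (hα : ∀ j < n, ‖α j‖ < 1) (hb : ‖b‖ = 1) {m : ℕ} (hm : m < n) :
    ∃ g, IsCircleLift (n - m) g fun ζ => pseudo n α b ζ m := by
  obtain ⟨g, hg⟩ := exists_lift_mul_pseudo hα hb (n - (m + 1)) (by omega)
  have h := hg.mob (hα m hm)
  rw [show n - (m + 1) + 1 = n - m by omega] at h
  refine ⟨_, h.congr fun ζ hζ => ?_⟩
  rw [pseudo_of_lt hm hζ, show n - (n - (m + 1)) = m + 1 by omega]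

/-- Rotations commute with the recursion: `mob (β * a) (β * z) = β * mob a z` for `|β| = 1`. -/
lemma pseudo_mul_const {β : ℂ} (hβ : ‖β‖ = 1) (hζ : ‖ζ‖ = 1) {m : ℕ} (k : ℕ) (hk : k + m ≤ n) :
    pseudo n (fun j => if m ≤ j then β * α j else α j) (β * b) ζ (n - k) =
      β * pseudo n α b ζ (n - k) := by
  induction k with
  | zero => simp [pseudo_self]
  | succ k ih =>
    have hlt : n - (k + 1) < n := by omega
    rw [pseudo_of_lt hlt hζ, pseudo_of_lt hlt hζ,
      show n - (k + 1) + 1 = n - k by omega, ih (by omega), if_pos (by omega : m ≤ n - (k + 1)),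
      mob, mob, ← mul_div_assoc]
    congr 1
    · ring
    · rw [map_mul]
      linear_combination conj (α (n - (k + 1))) * ζ * pseudo n α b ζ (n - k) *
        conj_mul_self_of_norm hβ

lemma pseudoSteps_shift {l p : ℕ} (k : ℕ) (hk : k ≤ p) :
    pseudoSteps p (fun j => α (l + j)) b ζ k = pseudoSteps (l + p) α b ζ k := by
  induction k with
  | zero => rfl
  | succ k ih =>
    rw [pseudoSteps, pseudoSteps, ih (by omega), show l + p - (k + 1) = l + (p - (k + 1)) by omega]

lemma pseudo_shift {l : ℕ} (hl : l ≤ n) :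
    pseudo (n - l) (fun j => α (l + j)) b ζ 0 = pseudo n α b ζ l := by
  rw [pseudo, pseudo, pseudoSteps_shift _ (by omega), show l + (n - l) = n by omega, Nat.sub_zero]

/-- One coefficient passes from the forward to the backward recursion: with `p = ζ b_{j+1}(ζ)` and
`s = s_j(ζ)`, both conditions read `s * p + α_j * s = 1 + conj α_j * p` after clearing denominators.
-/
lemma pseudo_mul_szegoMap_iff (hα : ∀ j < n, ‖α j‖ < 1) (hb : ‖b‖ = 1) {c : ℂ} (hc : ‖c‖ = 1)
    (hζ : ‖ζ‖ = 1) {m : ℕ} (hm : m ≤ n) :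
    b * szegoMap α c n ζ = 1 ↔ szegoMap α c m ζ * pseudo n α b ζ m = 1 := by
  induction hm using Nat.decreasingInduction with
  | self => rw [pseudo_self, mul_comm]
  | of_succ j hj ih =>
    rw [ih, pseudo_of_lt (j := j) hj hζ]
    obtain ⟨g, hg⟩ := exists_lift_szegoMap hc j fun i hi => hα i (hi.trans hj)
    have hh := hg.norm_eq hζ
    have hp := norm_pseudo hα hb (show j + 1 ≤ n from hj) hζ
    have hd1 : 1 + conj (α j) * (ζ * pseudo n α b ζ (j + 1)) ≠ 0 :=
      one_add_mul_ne_zero (by simpa using hα j hj) (by rw [norm_mul, hζ, hp, one_mul])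
    have hd2 : 1 + (-α j) * szegoMap α c j ζ ≠ 0 :=
      one_add_mul_ne_zero (by simpa using hα j hj) hh
    rw [szegoMap, mob, mob, map_neg, Complex.conj_conj, mul_div_assoc', mul_div_assoc',
      div_mul_eq_mul_div, div_eq_one_iff_eq hd1, div_eq_one_iff_eq hd2]
    constructor <;> intro h <;> linear_combination h

end pseudo

/-! ### The spectra and the two parts of the theorem -/

section spectra

variable {n m : ℕ} {α : ℕ → ℂ} {b c : ℂ}

lemma spectrum_cmv (hα : ∀ j < n, ‖α j‖ < 1) (hb : ‖b‖ = 1) :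
    spectrum ℂ (cmv n α b) = fib fun ζ => b * szegoMap α 1 n ζ := by
  have h := spectrum_cmvDiag (c := 1) hα hb (by simp)
  simpa [cmvDiag] using h

lemma spectrum_cmv_eq_fib_pseudo (hα : ∀ j < n, ‖α j‖ < 1) (hb : ‖b‖ = 1) (hm : m ≤ n) :
    spectrum ℂ (cmv n α b) = fib fun ζ => szegoMap α 1 m ζ * pseudo n α b ζ m := by
  rw [spectrum_cmv hα hb]
  ext ζ
  exact and_congr_right fun hζ => pseudo_mul_szegoMap_iff hα hb (by simp) hζ hm

lemma gam_eq (a c : ℂ) : gam a c = mob (-a) c := by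
  rw [gam, mob, ← neg_div_neg_eq, map_neg]
  ring_nf

lemma mob_neg_eq_iff {a z w : ℂ} (ha : ‖a‖ < 1) (hz : ‖z‖ = 1) (hw : ‖w‖ = 1) :
    z = mob (-a) w ↔ mob a z = w := by
  have hd1 : 1 + conj a * z ≠ 0 := one_add_mul_ne_zero (by simpa using ha) hz
  have hd2 : 1 + conj (-a) * w ≠ 0 := one_add_mul_ne_zero (by simpa using ha) hw
  rw [mob, mob, eq_div_iff hd2, div_eq_iff hd1, map_neg]
  constructor <;> intro h <;> linear_combination h

lemma norm_mob {a z : ℂ} (ha : ‖a‖ < 1) (hz : ‖z‖ = 1) : ‖mob a z‖ = 1 :=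
  (isCircleLift_id.mob ha).norm_eq hz

/-- The fibre condition for the shifted coefficients is `ζ b_{m+1}(ζ) = γ_m`. Since `γ_m` is the
preimage of `c` under `mob (α m)`, this says `b_m(ζ) = c`. -/
lemma spectrum_matN (hα : ∀ j < n, ‖α j‖ < 1) (hb : ‖b‖ = 1) (hm : m < n) (hc : ‖c‖ = 1) :
    spectrum ℂ (matN n m α b c) = fib fun ζ => conj c * pseudo n α b ζ m := by
  have hαm : ‖-α m‖ < 1 := by simpa using hα m hm
  have hγ : ‖gam (α m) c‖ = 1 := by rw [gam_eq]; exact norm_mob hαm hc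
  have hα' : ∀ j < n - (m + 1), ‖α (m + 1 + j)‖ < 1 := fun j hj => hα _ (by omega)
  have h := spectrum_cmvDiag (c := gam (α m) c) hα' hb hγ
  have hN : matN n m α b c =
    cmvDiag (n - (m + 1)) (fun j => α (m + 1 + j)) b (gam (α m) c) := rfl
  rw [hN, h]
  ext ζ
  refine and_congr_right fun hζ => ?_
  rw [pseudo_mul_szegoMap_iff hα' hb (by simpa using hγ) hζ (Nat.zero_le _), szegoMap,
    pseudo_shift hm]
  have hp := norm_pseudo (j := m + 1) hα hb hm hζ
  have hp' : ‖ζ * pseudo n α b ζ (m + 1)‖ = 1 := by rw [norm_mul, hζ, hp, one_mul]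
  have key {z w : ℂ} (hw : ‖w‖ = 1) : conj w * z = 1 ↔ z = w := by
    rw [conj_eq_inv hw, inv_mul_eq_one₀ (ne_zero_of_norm_eq_one hw), eq_comm]
  have e : ζ * conj (gam (α m) c) * pseudo n α b ζ (m + 1) =
    conj (gam (α m) c) * (ζ * pseudo n α b ζ (m + 1)) := by ring
  simp only [Nat.succ_eq_add_one]
  rw [e, key hγ, key hc, gam_eq, mob_neg_eq_iff (hα m hm) hp' hc, ← pseudo_of_lt hm hζ]

lemma szegoMap_congr {α' : ℕ → ℂ} (h : ∀ j < m, α j = α' j) (ζ : ℂ) :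
    szegoMap α c m ζ = szegoMap α' c m ζ := by
  induction m with
  | zero => rfl
  | succ m ih =>
    rw [szegoMap, szegoMap, ih fun j hj => h j (hj.trans m.lt_succ_self), h m m.lt_succ_self]

theorem strictlyInterlace_spectrum_rotation (hα : ∀ j < n, ‖α j‖ < 1) (hb : ‖b‖ = 1) {β : ℂ}
    (hβ : ‖β‖ = 1) (hβ1 : β ≠ 1) (hm : m ≤ n) :
    StrictlyInterlace (spectrum ℂ (cmv n α b))
      (spectrum ℂ (cmv n (fun j => if m ≤ j then β * α j else α j) (β * b))) := by
  have hα' : ∀ j < n, ‖if m ≤ j then β * α j else α j‖ < 1 := by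
    intro j hj
    split_ifs
    · rw [norm_mul, hβ, one_mul]; exact hα j hj
    · exact hα j hj
  -- For `m = n` the second factor is the constant `b`, which only shifts the lift.
  have hL : ∃ d g, IsCircleLift d g fun ζ => szegoMap α 1 m ζ * pseudo n α b ζ m := by
    obtain ⟨g, hg⟩ := exists_lift_szegoMap (c := 1) (by simp) m fun j hj => hα j (by omega)
    rcases hm.eq_or_lt with rfl | hm
    · obtain ⟨θ, rfl⟩ := exists_ex hb
      refine ⟨_, _, (hg.const_mul θ).congr fun ζ _ => ?_⟩
      rw [pseudo_self, mul_comm]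
    · obtain ⟨g', hg'⟩ := exists_lift_pseudo hα hb hm
      exact ⟨_, _, hg.mul hg'⟩
  obtain ⟨d, g, hg⟩ := hL
  have h := strictlyInterlace_fib_const_mul hg hβ hβ1
  rw [spectrum_cmv_eq_fib_pseudo hα hb hm,
    spectrum_cmv_eq_fib_pseudo hα' (by rw [norm_mul, hβ, hb, one_mul]) hm]
  convert h using 1
  ext ζ
  refine and_congr_right fun hζ => ?_
  have hp := pseudo_mul_const (α := α) (b := b) hβ hζ (n := n) (m := m) (n - m) (by omega)
  rw [show n - (n - m) = m by omega] at hp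
  simp only []
  rw [hp, szegoMap_congr (α' := α) fun j hj => if_neg (by omega)]
  ring_nf

theorem spectrum_truncation (hα : ∀ j < n, ‖α j‖ < 1) (hb : ‖b‖ = 1) (hm : m < n)
    (hc : ‖c‖ = 1) :
    (spectrum ℂ (cmv n α b) ∩ spectrum ℂ (cmv m α c)).encard
        ≤ ((min (m + 1) (n - m) : ℕ) : ℕ∞) ∧
      spectrum ℂ (cmv n α b) ∩ spectrum ℂ (cmv m α c) = setA n m α b c ∧
      setA n m α b c = spectrum ℂ (matN n m α b c) ∩ spectrum ℂ (cmv m α c) ∧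
      StrictlyInterlace (spectrum ℂ (cmv n α b) \ setA n m α b c)
        (spectrum ℂ (cmv m α c) ∪ setB n m α b c) := by
  have hαm : ∀ j < m, ‖α j‖ < 1 := fun j hj => hα j (hj.trans hm)
  obtain ⟨g, hg⟩ : ∃ g, IsCircleLift (m + 1) g fun ζ => c * szegoMap α 1 m ζ := by
    obtain ⟨g, hg⟩ := exists_lift_szegoMap (c := 1) (by simp) m hαm
    obtain ⟨θ, rfl⟩ := exists_ex hc
    exact ⟨_, hg.const_mul θ⟩
  obtain ⟨g', hg'⟩ : ∃ g', IsCircleLift (n - m) g' fun ζ => conj c * pseudo n α b ζ m := by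
    obtain ⟨g, hg⟩ := exists_lift_pseudo hα hb hm
    obtain ⟨θ, hθ⟩ := exists_ex (z := conj c) (by simpa using hc)
    exact ⟨_, hθ ▸ hg.const_mul θ⟩
  have hcc := conj_mul_self_of_norm hc
  have e1 : spectrum ℂ (cmv n α b) =
      fib fun ζ => c * szegoMap α 1 m ζ * (conj c * pseudo n α b ζ m) := by
    rw [spectrum_cmv_eq_fib_pseudo hα hb hm.le]
    congr 1
    funext ζ
    linear_combination (-szegoMap α 1 m ζ * pseudo n α b ζ m) * hcc
  have e2 := spectrum_cmv hαm hc
  have e3 := spectrum_matN hα hb hm hc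
  have hA : setA n m α b c = spectrum ℂ (matN n m α b c) ∩ spectrum ℂ (cmv m α c) := by
    rw [setA, e3]
    congr 1
    ext ζ
    refine and_congr_right fun _ => ?_
    rw [conj_eq_inv hc, inv_mul_eq_one₀ (ne_zero_of_norm_eq_one hc), eq_comm]
  have hA' : setA n m α b c =
      (fib fun ζ => c * szegoMap α 1 m ζ) ∩ fib fun ζ => conj c * pseudo n α b ζ m := by
    rw [hA, e2, e3, Set.inter_comm]
  have hI : spectrum ℂ (cmv n α b) ∩ spectrum ℂ (cmv m α c) = setA n m α b c := by
    rw [hA', e1, e2]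
    ext ζ
    constructor
    · rintro ⟨h1, h2⟩
      exact ⟨h2, h1.1, by simpa only [h2.2, one_mul] using h1.2⟩
    · exact fun h => ⟨inter_fib_subset_mul h, h.1⟩
  refine ⟨?_, hI, hA, ?_⟩
  · rw [hI, hA']
    -- The set is an intersection of fibres with `m + 1` and `n - m` points.
    rcases min_choice (m + 1) (n - m) with h | h <;> rw [h]
    · exact encard_fib hg ▸ Set.encard_le_encard Set.inter_subset_left
    · exact encard_fib hg' ▸ Set.encard_le_encard Set.inter_subset_right
  · have h := strictlyInterlace_mul_union hg hg'
    rw [← e1, ← hA', ← e2, ← e3] at h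
    -- Removing `A` from `σ(N)` does not change the union, since `A` lies in the other spectrum.
    convert h using 1
    rw [setB, hA]
    ext ζ
    simp only [Set.mem_union, Set.mem_sdiff, Set.mem_inter_iff]
    tauto

end spectra

end CMV

end

theorem theorem1 (n : ℕ) (α : ℕ → ℂ) (hα : ∀ j < n, ‖α j‖ < 1) (b : ℂ) (hb : ‖b‖ = 1) :
    (∀ β : ℂ, ‖β‖ = 1 → β ≠ 1 → ∀ m ≤ n,
      CMV.StrictlyInterlace (spectrum ℂ (CMV.cmv n α b))
        (spectrum ℂ (CMV.cmv n (fun j => if m ≤ j then β * α j else α j) (β * b)))) ∧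
    (∀ m < n, ∀ c : ℂ, ‖c‖ = 1 →
      (spectrum ℂ (CMV.cmv n α b) ∩ spectrum ℂ (CMV.cmv m α c)).encard
          ≤ ((min (m + 1) (n - m) : ℕ) : ℕ∞) ∧
      spectrum ℂ (CMV.cmv n α b) ∩ spectrum ℂ (CMV.cmv m α c) = CMV.setA n m α b c ∧
      CMV.setA n m α b c =
        spectrum ℂ (CMV.matN n m α b c) ∩ spectrum ℂ (CMV.cmv m α c) ∧
      CMV.StrictlyInterlace (spectrum ℂ (CMV.cmv n α b) \ CMV.setA n m α b c)
        (spectrum ℂ (CMV.cmv m α c) ∪ CMV.setB n m α b c)) := by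
  exact ⟨fun _ hβ hβ1 _ hm => CMV.strictlyInterlace_spectrum_rotation hα hb hβ hβ1 hm,
    fun _ hm _ hc => CMV.spectrum_truncation hα hb hm hc⟩
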